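/- Let $G=(V,E)$ be a finite undirected graph, possibly with loops (multiple edges are allowed as well). A \emph{magic labeling} of $G$ is a function $L\colon E\to\mathbb{Z}_{\ge 0}$ such that the sum $s_L(v)=\sum_{e\in E,\ e\ni v}L(e)$ (a loop being counted once) is the same for all $v\in V$; it has \emph{index} $r$ if $s_L(v)=r$ for all $v\in V$. For $k\in\mathbb{Z}_{\ge 0}$ let $M_G(k)$ be the number of magic labelings $L$ of $G$ with $L(e)\le k$ for all $e\in E$. A function $F\colon\mathbb{Z}_{\ge 0}\to\mathbb{C}$ is a \emph{quasipolynomial} with \emph{quasiperiod} $s\ge 1$ if on each residue class modulo $s$ it agrees with a polynomial over $\mathbb{C}$. (1) Suppose there is an edge $e\in E$ that attains the maximum label in every magic labeling of $G$ of index $2$. Then $M_G$ is a quasipolynomial with a quasiperiod at most $2$. If $G$ is furthermore bipartite, then $M_G$ is a polynomial. (2) Suppose that $G$ is bipartite with an even number of vertices, and let $\mathrm{mp}(G)$ be its matching preclusion number, i.e. the minimum cardinality of an edge set $S$ such that $G-S$ has no perfect matching ($\infty$ if there is no such $S$). If $\mathrm{mp}(G)\le 1$, then $M_G$ is a polynomial.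 Moreover, if $E\neq\emptyset$, then $\mathrm{mp}(G)\le 1$ if and only if there is an edge that attains the maximum label in every magic labeling of $G$ of index $2$. -/

import Mathlib

namespace MagicGraph

/-- The sum `s_L(v)` of the labels of the edges of `G` that contain `v`;
a loop at `v` is one edge containing `v`, so its label is counted once. -/
noncomputable def vertexSum {α β : Type*} (G : Graph α β) (L : G.edgeSet → ℕ) (v : α) : ℕ :=
  ∑ᶠ e ∈ {e : G.edgeSet | G.Inc (e : β) v}, L e

/-- A labeling of the edges by nonnegative integers is magic if all vertex sums agree. -/
def IsMagic {α β : Type*} (G : Graph α β) (L : G.edgeSet → ℕ) : Prop :=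
  ∀ v ∈ G.vertexSet, ∀ w ∈ G.vertexSet, vertexSum G L v = vertexSum G L w

/-- `L` is a magic labeling of index `r`: every vertex sum equals `r`. -/
def IsMagicOfIndex {α β : Type*} (G : Graph α β) (L : G.edgeSet → ℕ) (r : ℕ) : Prop :=
  ∀ v ∈ G.vertexSet, vertexSum G L v = r

/-- `M_G(k)`, the number of magic labelings of `G` all of whose labels are at most `k`. -/
noncomputable def magicCount {α β : Type*} (G : Graph α β) (k : ℕ) : ℕ :=
  {L : G.edgeSet → ℕ | IsMagic G L ∧ ∀ e, L e ≤ k}.ncard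

/-- Some edge attains the maximum label in every magic labeling of index `2`. -/
def HasCommonMaxEdge {α β : Type*} (G : Graph α β) : Prop :=
  ∃ e : G.edgeSet, ∀ L : G.edgeSet → ℕ, IsMagicOfIndex G L 2 → ∀ f, L f ≤ L e

/-- The vertices split into two classes such that every edge joins the two classes
(in particular there are no loops). -/
def IsBipartite {α β : Type*} (G : Graph α β) : Prop :=
  ∃ A : Set α, ∀ e x y, G.IsLink e x y → (x ∈ A ↔ y ∉ A)

/-- A set of non-loop edges such that each vertex lies in exactly one of them. -/
def IsPerfectMatching {α β : Type*} (G : Graph α β) (M : Set β) : Prop :=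
  M ⊆ G.edgeSet ∧ (∀ e ∈ M, ∀ x, ¬ G.IsLoopAt e x) ∧
    ∀ v ∈ G.vertexSet, ∃! e, e ∈ M ∧ G.Inc e v

/-- The minimum cardinality of an edge set `S` such that `G - S` has no perfect matching
(`⊤` if there is no such set). -/
noncomputable def matchingPreclusion {α β : Type*} (G : Graph α β) : ℕ∞ :=
  ⨅ S ∈ {S : Set β | S ⊆ G.edgeSet ∧ ¬ ∃ M, IsPerfectMatching (G.deleteEdges S) M}, S.encard

/-- `F` is a quasipolynomial having the positive integer `s` as a quasiperiod:
on each residue class modulo `s` it agrees with a polynomial. -/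
def HasQuasiperiod (F : ℕ → ℂ) (s : ℕ) : Prop :=
  0 < s ∧ ∃ φ : ℕ → Polynomial ℂ, ∀ t : ℕ, F t = (φ (t % s)).eval (t : ℂ)

/-- `F` is a polynomial function on the nonnegative integers. -/
def IsPolynomial (F : ℕ → ℂ) : Prop :=
  ∃ p : Polynomial ℂ, ∀ t : ℕ, F t = p.eval (t : ℂ)

end MagicGraph

/-!
Nonnegative magic labelings are the nonnegative vectors of a rational subspace, the `magicSpace`.
When the edge `e` carries the maximum of every magic labeling, `magicCount G k` counts the lattice
points `L` of the resulting cone that satisfy the single inequality `L e ≤ k`, so it is an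
Ehrhart-type counting function.

The generators. A nonzero nonnegative magic labeling of index `r` is `r` times a doubly stochastic
matrix indexed by the vertices. By Birkhoff's theorem a permutation of the vertices moves each
vertex along an edge of the support (`exists_perm_of_mem_magicSpace`); counting how often each edge
is used gives a magic labeling of index `2` within the support (`exists_index_two`). In a bipartite
graph, using only the vertices of one side gives one of index `1`, that is, a perfect matching
(`exists_index_one`).

The decomposition. Choose a generator `gen S` for every possible support `S`, and reduce a vector
by the largest multiple of the generator chosen for its support. The support shrinks, so after
finitely many steps the vector is written as a combination with positive coefficients of a list of
generators. The lists that occur (`IsPulling`) are finite in number, their members are linearly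
independent, and the open simplicial cones they span partition the whole cone
(`exists_isPulling`, `IsPulling.unique`). In particular a coordinate that is maximal in all
generators is maximal everywhere (`Generates.le_of_forall_le`).

The count. In an open simplicial cone, split each coefficient as `a + n` with `n : ℕ` and
`a ∈ (0, 1]`. Only finitely many `a` are possible for lattice points, and peeling off the generators
one at a time leads to a recurrence `F k = F (k - g e) + N k`, which preserves quasipolynomials of
any quasiperiod divisible by `g e` (`AgreesQuasi.of_recurrence`, `hasQuasiCount_conePoints`). As
`a ≤ 1`, each step extends the range of validity down to the apex of the cone, so that no small `k`
is exceptional. For generators of index `2` one has `g e ∈ {1, 2}`, whence the quasiperiod `2`; for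
perfect matchings `g e = 1`, whence a polynomial.

Matching preclusion. `matchingPreclusion G ≤ 1` means, if there are edges at all, that some edge
lies in every perfect matching. Such an edge is maximal in all generators of index `1`, hence in
every magic labeling. Conversely, twice the indicator of a perfect matching avoiding `e` is a magic
labeling of index `2` in which `e` is not maximal.
-/

open Polynomial

namespace MagicGraph

/-! ### Quasipolynomials on a half-line -/

/-- `F` agrees with a quasipolynomial of quasiperiod `s` at all integers `k ≥ β`. Nothing is asked
below `β`, where the counting functions that occur here vanish. -/
def AgreesQuasi (s : ℕ) (β : ℚ) (F : ℤ → ℚ) : Prop :=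
  ∃ φ : ℤ → ℚ[X], ∀ k : ℤ, β ≤ k → F k = (φ (k % s)).eval (k : ℚ)

theorem AgreesQuasi.mono {s : ℕ} {β β' : ℚ} {F : ℤ → ℚ} (h : AgreesQuasi s β F) (hβ : β ≤ β') :
    AgreesQuasi s β' F := by
  obtain ⟨φ, hφ⟩ := h
  exact ⟨φ, fun k hk => hφ k (hβ.trans hk)⟩

theorem AgreesQuasi.add {s : ℕ} {β : ℚ} {F F' : ℤ → ℚ} (h : AgreesQuasi s β F)
    (h' : AgreesQuasi s β F') : AgreesQuasi s β (fun k => F k + F' k) := by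
  obtain ⟨φ, hφ⟩ := h
  obtain ⟨ψ, hψ⟩ := h'
  exact ⟨fun a => φ a + ψ a, fun k hk => by simp [hφ k hk, hψ k hk]⟩

theorem agreesQuasi_const (s : ℕ) {β : ℚ} {F : ℤ → ℚ} (c : ℚ) (h : ∀ k : ℤ, β ≤ k → F k = c) :
    AgreesQuasi s β F :=
  ⟨fun _ => C c, fun k hk => by simp [h k hk]⟩

/-- Every polynomial has a polynomial antidifference of step `s`; for a monomial it is a rescaled
Bernoulli polynomial. -/
theorem exists_antidifference (s : ℚ) (hs : s ≠ 0) (p : ℚ[X]) :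
    ∃ P : ℚ[X], ∀ x : ℚ, P.eval x - P.eval (x - s) = p.eval x := by
  induction p using Polynomial.induction_on' with
  | add p q hp hq =>
    obtain ⟨P, hP⟩ := hp
    obtain ⟨Q, hQ⟩ := hq
    exact ⟨P + Q, fun x => by simp only [eval_add, ← hP, ← hQ]; ring⟩
  | monomial n a =>
    refine ⟨C (a * s ^ n / (n + 1)) * (Polynomial.bernoulli (n + 1)).comp (1 + C s⁻¹ * X),
      fun x => ?_⟩
    have h := Polynomial.bernoulli_eval_one_add (n + 1) (s⁻¹ * x)
    have h2 : 1 + s⁻¹ * (x - s) = s⁻¹ * x := by field_simp; ring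
    have hn : (n : ℚ) + 1 ≠ 0 := by positivity
    rw [Nat.add_sub_cancel, mul_pow, inv_pow] at h
    simp only [eval_mul, eval_C, eval_comp, eval_add, eval_one, eval_X, eval_monomial, h, h2]
    push_cast
    field_simp
    ring

/-- Summation along steps of length `d` preserves quasipolynomiality, and the domain of validity
grows by one step: the values on `[β - d, β)` are initial values, one for each residue class modulo
`d`, and only contribute to the constant terms of the polynomials. -/
theorem AgreesQuasi.of_recurrence {s d : ℕ} (hs : 0 < s) (hds : d ∣ s) {β : ℚ} {F N : ℤ → ℚ}
    (hrec : ∀ k, F k = F (k - d) + N k) (hN : AgreesQuasi s β N) :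
    AgreesQuasi s (β - d) F := by
  obtain ⟨t, rfl⟩ := hds
  obtain ⟨φ, hφ⟩ := hN
  set s := d * t with hsdef
  have hsQ : (s : ℚ) ≠ 0 := by positivity
  have tele : ∀ (n : ℕ) (k : ℤ), F k = F (k - n * d) + ∑ i ∈ Finset.range n, N (k - i * d) := by
    intro n
    induction n with
    | zero => simp
    | succ n ih =>
      intro k
      rw [Finset.sum_range_succ, ih k, hrec (k - n * d)]
      have : k - (n : ℤ) * d - d = k - ((n + 1 : ℕ) : ℤ) * d := by push_cast; ring
      rw [this]; ring
  have step : ∀ a : ℤ, ∃ P : ℚ[X], ∀ k : ℤ, k % s = a → β - d + s ≤ k →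
      F k - F (k - s) = P.eval (k : ℚ) - P.eval ((k : ℚ) - s) := by
    intro a
    obtain ⟨P, hP⟩ := exists_antidifference s hsQ
      (∑ i ∈ Finset.range t, (φ ((a - i * d) % s)).comp (X - C ((i : ℚ) * d)))
    refine ⟨P, fun k hk hkβ => ?_⟩
    rw [hP, tele t k]
    have h1 : (k : ℤ) - (t : ℤ) * d = k - s := by rw [hsdef]; push_cast; ring
    rw [h1, add_sub_cancel_left, eval_finsetSum]
    refine Finset.sum_congr rfl fun i hi => ?_
    have hi : i + 1 ≤ t := Finset.mem_range.1 hi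
    have hi' : ((i : ℚ) + 1) * d ≤ s := by
      rw [hsdef]; push_cast; rw [mul_comm]
      exact mul_le_mul_of_nonneg_left (by exact_mod_cast hi) (by positivity)
    rw [hφ _ (by push_cast; linarith), ← hk, Int.emod_sub_emod]
    simp
  choose P hP using step
  set k0 : ℤ := ⌈β - d⌉ with hk0
  let start : ℤ → ℤ := fun a => k0 + (a - k0) % s
  refine ⟨fun a => P a + C (F (start a) - (P a).eval (start a : ℚ)), fun k hk => ?_⟩
  have hsZ : (0 : ℤ) < s := by exact_mod_cast hs
  have hkk : k0 ≤ k := Int.ceil_le.2 hk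
  obtain ⟨j, hj⟩ : ∃ j : ℕ, k = start (k % s) + s * j := by
    refine ⟨((k - k0) / s).toNat, ?_⟩
    rw [Int.toNat_of_nonneg (Int.ediv_nonneg (by omega) hsZ.le)]
    simp only [start, Int.emod_sub_emod]
    have := Int.emod_add_mul_ediv (k - k0) s
    linarith
  generalize ha : k % s = a at hj ⊢
  have hst : start a % s = a := by
    rw [hj] at ha
    simpa using ha
  have hst0 : β - d ≤ (start a : ℚ) := by
    have h1 : β - d ≤ k0 := Int.le_ceil _
    have h2 : (0 : ℤ) ≤ (a - k0) % s := Int.emod_nonneg _ hsZ.ne'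
    have h3 : k0 ≤ start a := by simp only [start]; omega
    exact h1.trans (by exact_mod_cast h3)
  subst hj
  clear ha hk hkk
  induction j with
  | zero => simp
  | succ j ih =>
    have h := hP a (start a + s * (j + 1 : ℕ)) (by simp [hst]) (by
      push_cast
      have : (0 : ℚ) ≤ s * j := by positivity
      linarith)
    have e1 : start a + (s : ℤ) * (j + 1 : ℕ) - s = start a + s * j := by push_cast; ring
    have e2 : ((start a + (s : ℤ) * (j + 1 : ℕ) : ℤ) : ℚ) - s = ((start a + s * j : ℤ) : ℚ) := by
      push_cast; ring
    rw [e1, e2] at h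
    simp only [eval_add, eval_C] at ih ⊢
    linarith

/-- The sets `X k` are finite, and from `β` on their sizes are given by a quasipolynomial of
quasiperiod `s`. -/
def HasQuasiCount {γ : Type*} (s : ℕ) (β : ℚ) (X : ℤ → Set γ) : Prop :=
  (∀ k, (X k).Finite) ∧ AgreesQuasi s β (fun k => ((X k).ncard : ℚ))

theorem HasQuasiCount.biUnion {γ τ : Type*} {s : ℕ} {β : ℚ} (T : Finset τ) (X : τ → ℤ → Set γ)
    (hX : ∀ i ∈ T, HasQuasiCount s β (X i))
    (hdisj : ∀ i ∈ T, ∀ j ∈ T, ∀ k x, x ∈ X i k → x ∈ X j k → i = j) :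
    HasQuasiCount s β (fun k => ⋃ i ∈ T, X i k) := by
  classical
  induction T using Finset.induction_on with
  | empty => exact ⟨by simp, agreesQuasi_const s 0 (by simp)⟩
  | insert a T ha ih =>
    obtain ⟨hf, hq⟩ := ih (fun i hi => hX i (Finset.mem_insert_of_mem hi))
      (fun i hi j hj => hdisj i (Finset.mem_insert_of_mem hi) j (Finset.mem_insert_of_mem hj))
    obtain ⟨hfa, hqa⟩ := hX a (Finset.mem_insert_self a T)
    simp only [Finset.set_biUnion_insert]
    refine ⟨fun k => (hfa k).union (hf k), ?_⟩
    convert hqa.add hq using 2 with k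
    rw [Set.ncard_union_eq _ (hfa k) (hf k)]
    · push_cast; rfl
    · rw [Set.disjoint_left]
      intro x hx hx'
      obtain ⟨i, hi, hxi⟩ := Set.mem_iUnion₂.1 hx'
      have := hdisj a (Finset.mem_insert_self a T) i (Finset.mem_insert_of_mem hi) k x hx hxi
      exact ha (this ▸ hi)

/-! ### Lattice points in open simplicial cones -/

variable {ι : Type*}

/-- The union of the supports of the members of `l`. -/
def listSupport (l : List (ι → ℕ)) : Set ι := {i | ∃ g ∈ l, g i ≠ 0}

theorem listSupport_cons (g : ι → ℕ) (l : List (ι → ℕ)) :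
    listSupport (g :: l) = Function.support g ∪ listSupport l := by
  ext i; simp [listSupport]

/-- The relatively open cone spanned by the members of `l`: their combinations with positive
rational coefficients. -/
def openCone : List (ι → ℕ) → Set (ι → ℚ)
  | [] => {0}
  | g :: l => {L | ∃ c : ℚ, 0 < c ∧ ∃ M ∈ openCone l, L = fun i => c * g i + M i}

theorem openCone_nonneg {l : List (ι → ℕ)} {L : ι → ℚ} (h : L ∈ openCone l) (i : ι) :
    0 ≤ L i := by
  induction l generalizing L with
  | nil => rw [openCone, Set.mem_singleton_iff] at h; simp [h]
  | cons g l ih =>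
    obtain ⟨c, hc, M, hM, rfl⟩ := h
    have := ih hM
    positivity

theorem support_of_mem_openCone {l : List (ι → ℕ)} {L : ι → ℚ} (h : L ∈ openCone l) :
    Function.support L = listSupport l := by
  induction l generalizing L with
  | nil => rw [openCone, Set.mem_singleton_iff] at h; simp [h, listSupport]
  | cons g l ih =>
    obtain ⟨c, hc, M, hM, rfl⟩ := h
    rw [listSupport_cons, ← ih hM]
    ext i
    have h1 := openCone_nonneg hM i
    have h2 : 0 ≤ c * (g i : ℚ) := by positivity
    simp only [Function.mem_support, Set.mem_union, ne_eq, add_eq_zero_iff_of_nonneg h2 h1,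
      mul_eq_zero, hc.ne', false_or, Nat.cast_eq_zero]
    tauto

theorem eq_zero_of_notMem_listSupport {l : List (ι → ℕ)} {L : ι → ℚ} (h : L ∈ openCone l) {i : ι}
    (hi : i ∉ listSupport l) : L i = 0 := by
  rw [← support_of_mem_openCone h] at hi
  simpa using hi

/-- Each member of the list has a coordinate in its support outside the supports of the later
ones; in particular the members are linearly independent. -/
def IsTriangular : List (ι → ℕ) → Prop
  | [] => True
  | g :: l => IsTriangular l ∧ ¬ Function.support g ⊆ listSupport l

/-- The lattice points `L` of the translated cone `b + openCone l` with `L e ≤ k`. -/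
def conePoints (l : List (ι → ℕ)) (e : ι) (b : ι → ℚ) (k : ℤ) : Set (ι → ℤ) :=
  {L | (∃ M ∈ openCone l, ∀ i, (L i : ℚ) = b i + M i) ∧ L e ≤ k}

/-- The lattice points of `b + openCone (g :: l)` for which the coefficient of `g` is congruent
to `a` modulo `1`. -/
def coneSlice (g : ι → ℕ) (l : List (ι → ℕ)) (e : ι) (b : ι → ℚ) (a : ℚ) (k : ℤ) :
    Set (ι → ℤ) :=
  {L | (∃ n : ℕ, ∃ M ∈ openCone l, ∀ i, (L i : ℚ) = b i + ((a + n) * g i + M i)) ∧ L e ≤ k}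

theorem coneSlice_eq_union (g : ι → ℕ) (l : List (ι → ℕ)) (e : ι) (b : ι → ℚ) (a : ℚ) (k : ℤ) :
    coneSlice g l e b a k =
      (fun (L : ι → ℤ) i => L i + (g i : ℤ)) '' coneSlice g l e b a (k - g e) ∪
        conePoints l e (fun i => b i + a * g i) k := by
  ext L
  constructor
  · rintro ⟨⟨n, M, hM, hL⟩, hk⟩
    cases n with
    | zero => exact Or.inr ⟨⟨M, hM, fun i => by rw [hL i]; simp; ring⟩, hk⟩
    | succ n =>
      refine Or.inl ⟨fun i => L i - g i, ⟨⟨n, M, hM, fun i => ?_⟩, by simpa using hk⟩, by simp⟩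
      push_cast
      rw [hL i]; push_cast; ring
  · rintro (⟨L, ⟨⟨n, M, hM, hL⟩, hk⟩, rfl⟩ | ⟨⟨M, hM, hL⟩, hk⟩)
    · refine ⟨⟨n + 1, M, hM, fun i => ?_⟩, by simp only; omega⟩
      push_cast
      rw [hL i]; ring
    · exact ⟨⟨0, M, hM, fun i => by rw [hL i]; simp; ring⟩, hk⟩

/-- Splitting off multiples of `g` turns the count on a slice into the count for the remaining
cone, summed along steps of length `g e`. -/
theorem hasQuasiCount_coneSlice {s : ℕ} (hs : 0 < s) {g : ι → ℕ} {l : List (ι → ℕ)} {e f : ι}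
    (hf : g f ≠ 0) (hfl : f ∉ listSupport l) (hge : g e ≠ 0) (hgs : g e ∣ s) (b : ι → ℚ) {a : ℚ}
    (ha0 : 0 < a) (ha1 : a ≤ 1)
    (hl : HasQuasiCount s (b e + a * g e) (conePoints l e fun i => b i + a * g i)) :
    HasQuasiCount s (b e) (coneSlice g l e b a) := by
  have hgQ : (0 : ℚ) < g e := by positivity
  have hinj : Function.Injective (fun (L : ι → ℤ) i => L i + (g i : ℤ)) := by
    intro L L' h
    ext i
    simpa using congrFun h i
  have hempty : ∀ k : ℤ, (k : ℚ) < b e → coneSlice g l e b a k = ∅ := by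
    intro k hk
    rw [Set.eq_empty_iff_forall_notMem]
    rintro L ⟨⟨n, M, hM, hL⟩, hLk⟩
    have h1 : (L e : ℚ) ≤ k := by exact_mod_cast hLk
    have h2 : 0 ≤ (a + n) * (g e : ℚ) := by positivity
    have h3 := openCone_nonneg hM e
    rw [hL e] at h1
    linarith
  have hfin : ∀ k, (coneSlice g l e b a k).Finite := by
    have key : ∀ (j : ℕ) (k : ℤ), (k : ℚ) < b e + j → (coneSlice g l e b a k).Finite := by
      intro j
      induction j with
      | zero => intro k hk; rw [hempty k (by simpa using hk)]; exact Set.finite_empty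
      | succ j ih =>
        intro k hk
        rw [coneSlice_eq_union]
        refine ((ih _ ?_).image _).union (hl.1 k)
        have : (1 : ℚ) ≤ g e := by exact_mod_cast Nat.one_le_iff_ne_zero.2 hge
        push_cast at hk ⊢
        linarith
    intro k
    obtain ⟨j, hj⟩ := exists_nat_gt ((k : ℚ) - b e)
    exact key j k (by linarith)
  refine ⟨hfin, ?_⟩
  refine (AgreesQuasi.of_recurrence (d := g e) hs hgs (fun k => ?_) hl.2).mono (by nlinarith)
  rw [coneSlice_eq_union g l e b a k, Set.ncard_union_eq _ ((hfin _).image _) (hl.1 k),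
    Set.ncard_image_of_injective _ hinj]
  · push_cast; rfl
  · rw [Set.disjoint_left]
    rintro _ ⟨L, ⟨⟨n, M, hM, hL⟩, -⟩, rfl⟩ ⟨⟨M', hM', hL'⟩, -⟩
    have h1 := hL f
    have h2 := hL' f
    rw [eq_zero_of_notMem_listSupport hM hfl] at h1
    rw [eq_zero_of_notMem_listSupport hM' hfl] at h2
    push_cast at h2
    have h3 : ((n : ℚ) + 1) * g f = 0 := by linarith
    have : ((n : ℚ) + 1) * g f ≠ 0 := by positivity
    contradiction

/-- Each coefficient of a lattice point is, modulo `1`, one of finitely many values: a coordinate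
at which only one generator is nonzero determines it. -/
theorem finite_fractional_coefficients (x y : ℚ) (hy : 0 < y) :
    {a : ℚ | 0 < a ∧ a ≤ 1 ∧ ∃ z : ℤ, (z : ℚ) = x + a * y}.Finite := by
  refine ((Set.finite_Icc ⌊x⌋ ⌈x + y⌉).image fun z : ℤ => ((z : ℚ) - x) / y).subset ?_
  rintro a ⟨ha0, ha1, z, hz⟩
  refine ⟨z, ⟨?_, ?_⟩, by simp [hz, hy.ne']⟩
  · have h1 : (⌊x⌋ : ℚ) ≤ z := (Int.floor_le x).trans (by rw [hz]; nlinarith)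
    exact_mod_cast h1
  · have h1 : (z : ℚ) ≤ ⌈x + y⌉ := le_trans (by rw [hz]; nlinarith) (Int.le_ceil _)
    exact_mod_cast h1

/-- Ehrhart's theorem for a translated open simplicial cone. -/
theorem hasQuasiCount_conePoints {s : ℕ} (hs : 0 < s) (e : ι) (l : List (ι → ℕ))
    (ht : IsTriangular l) (hl : ∀ g ∈ l, g e ≠ 0 ∧ g e ∣ s) (b : ι → ℚ) :
    HasQuasiCount s (b e) (conePoints l e b) := by
  induction l generalizing b with
  | nil =>
    have hsub : ∀ k, (conePoints [] e b k).Subsingleton := by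
      rintro k L ⟨⟨M, hM, hL⟩, -⟩ L' ⟨⟨M', hM', hL'⟩, -⟩
      rw [openCone, Set.mem_singleton_iff] at hM hM'
      subst hM hM'
      ext i
      exact_mod_cast (hL i).trans (hL' i).symm
    refine ⟨fun k => (hsub k).finite,
      agreesQuasi_const s (({L : ι → ℤ | ∀ i, (L i : ℚ) = b i}.ncard : ℕ) : ℚ) fun k hk => ?_⟩
    congr 2
    ext L
    simp only [conePoints, openCone, Set.mem_singleton_iff, exists_eq_left, Pi.zero_apply,
      add_zero, Set.mem_ofPred_eq, and_iff_left_iff_imp]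
    intro h
    have := h e
    exact_mod_cast this.trans_le hk
  | cons g l ih =>
    obtain ⟨htl, hg⟩ := ht
    obtain ⟨f, hf, hfl⟩ := Set.not_subset.1 hg
    rw [Function.mem_support] at hf
    have hfQ : (0 : ℚ) < g f := by positivity
    have hfin := finite_fractional_coefficients (b f) (g f) hfQ
    have hT : ∀ a, a ∈ hfin.toFinset ↔ 0 < a ∧ a ≤ 1 ∧ ∃ z : ℤ, (z : ℚ) = b f + a * g f := by
      simp
    have heq : conePoints (g :: l) e b =
        fun k => ⋃ a ∈ hfin.toFinset, coneSlice g l e b a k := by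
      ext k L
      simp only [Set.mem_iUnion, hT]
      constructor
      · rintro ⟨⟨_, ⟨c, hc, M, hM, rfl⟩, hL⟩, hk⟩
        -- `c = a + n` with `a ∈ (0, 1]`
        have hn : ((⌈c⌉.toNat - 1 : ℕ) : ℚ) = ⌈c⌉ - 1 := by
          have : 0 < ⌈c⌉ := Int.ceil_pos.2 hc
          have h2 : ((⌈c⌉.toNat - 1 : ℕ) : ℤ) = ⌈c⌉ - 1 := by omega
          exact_mod_cast congrArg (Int.cast : ℤ → ℚ) h2
        have h1 := Int.le_ceil c
        have h2 := Int.ceil_lt_add_one c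
        refine ⟨c - (⌈c⌉ - 1), ⟨by linarith, by linarith, L f - (⌈c⌉ - 1) * g f, ?_⟩,
          ⟨⌈c⌉.toNat - 1, M, hM, fun i => ?_⟩, hk⟩
        · push_cast
          have hLf : (L f : ℚ) = b f + (c * g f + M f) := hL f
          rw [hLf, eq_zero_of_notMem_listSupport hM hfl]
          ring
        · rw [hL i, hn]; ring
      · rintro ⟨a, ⟨ha0, -, -⟩, ⟨n, M, hM, hL⟩, hk⟩
        exact ⟨⟨_, ⟨a + n, by positivity, M, hM, rfl⟩, hL⟩, hk⟩
    rw [heq]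
    refine HasQuasiCount.biUnion _ _ (fun a ha => ?_) ?_
    · obtain ⟨ha0, ha1, -⟩ := (hT a).1 ha
      obtain ⟨hge, hgs⟩ := hl g (by simp)
      exact hasQuasiCount_coneSlice hs hf hfl hge hgs b ha0 ha1
        (ih htl (fun g' hg' => hl g' (by simp [hg'])) fun i => b i + a * g i)
    · rintro a ha a' ha' k L ⟨⟨n, M, hM, hL⟩, -⟩ ⟨⟨n', M', hM', hL'⟩, -⟩
      obtain ⟨ha0, ha1, -⟩ := (hT a).1 ha
      obtain ⟨ha0', ha1', -⟩ := (hT a').1 ha'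
      have h := (hL f).symm.trans (hL' f)
      rw [eq_zero_of_notMem_listSupport hM hfl, eq_zero_of_notMem_listSupport hM' hfl] at h
      have h' : a + n = a' + n' := by
        apply mul_right_cancel₀ hfQ.ne'
        linarith
      have h1 : (n : ℚ) < n' + 1 := by linarith
      have h2 : (n' : ℚ) < n + 1 := by linarith
      have h3 : n = n' := by
        have h1 : n < n' + 1 := by exact_mod_cast h1
        have h2 : n' < n + 1 := by exact_mod_cast h2
        omega
      subst h3
      linarith

/-! ### The pulling decomposition of a cone -/

/-- The lists arising from repeated pulling: `gen` prescribes a generator for every support, and a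
vector `L` is reduced by the largest multiple of `gen (support L)` that keeps it nonnegative, which
strictly decreases its support. -/
def IsPulling (gen : Set ι → ι → ℕ) : List (ι → ℕ) → Prop
  | [] => True
  | g :: l => IsPulling gen l ∧ gen (listSupport (g :: l)) = g ∧
      ¬ Function.support g ⊆ listSupport l

theorem IsPulling.isTriangular {gen : Set ι → ι → ℕ} {l : List (ι → ℕ)} (h : IsPulling gen l) :
    IsTriangular l := by
  induction l with
  | nil => trivial
  | cons g l ih => exact ⟨ih h.1, h.2.2⟩

theorem IsTriangular.length_le [Finite ι] {l : List (ι → ℕ)} (h : IsTriangular l) :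
    l.length ≤ (listSupport l).ncard := by
  induction l with
  | nil => simp
  | cons g l ih =>
    obtain ⟨i, hi, hil⟩ := Set.not_subset.1 h.2
    refine (Nat.succ_le_succ (ih h.1)).trans (Set.ncard_lt_ncard ?_ (Set.toFinite _))
    rw [listSupport_cons]
    exact ⟨Set.subset_union_right, fun hs => hil (hs (Or.inl hi))⟩

theorem finite_isPulling [Finite ι] (gen : Set ι → ι → ℕ) :
    {l : List (ι → ℕ) | IsPulling gen l}.Finite := by
  refine ((List.finite_length_le (Set ι) (Nat.card ι)).image (List.map gen)).subset ?_
  intro l hl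
  have hlen : l.length ≤ Nat.card ι :=
    (IsPulling.isTriangular hl).length_le.trans (Set.ncard_le_card _)
  have hmem : ∀ l : List (ι → ℕ), IsPulling gen l → ∃ l' : List (Set ι), l'.map gen = l := by
    intro l
    induction l with
    | nil => exact fun _ => ⟨[], rfl⟩
    | cons g l ih =>
      intro h
      obtain ⟨l', hl'⟩ := ih h.1
      exact ⟨listSupport (g :: l) :: l', by rw [List.map_cons, hl', h.2.1]⟩
  obtain ⟨l', rfl⟩ := hmem l hl
  exact ⟨l', by simpa using hlen, rfl⟩

/-- The open cones of different pulling lists are disjoint. -/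
theorem IsPulling.unique {gen : Set ι → ι → ℕ} {l l' : List (ι → ℕ)} (h : IsPulling gen l)
    (h' : IsPulling gen l') {L : ι → ℚ} (hL : L ∈ openCone l) (hL' : L ∈ openCone l') :
    l = l' := by
  have hsupp := (support_of_mem_openCone hL).symm.trans (support_of_mem_openCone hL')
  induction l generalizing l' L with
  | nil =>
    cases l' with
    | nil => rfl
    | cons g' l' =>
      obtain ⟨i, hi, -⟩ := Set.not_subset.1 h'.2.2
      have : i ∈ listSupport (g' :: l') := by rw [listSupport_cons]; exact Or.inl hi
      rw [← hsupp] at this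
      simp [listSupport] at this
  | cons g l ih =>
    cases l' with
    | nil =>
      obtain ⟨i, hi, -⟩ := Set.not_subset.1 h.2.2
      have : i ∈ listSupport (g :: l) := by rw [listSupport_cons]; exact Or.inl hi
      rw [hsupp] at this
      simp [listSupport] at this
    | cons g' l' =>
      have hg : g = g' := by rw [← h.2.1, ← h'.2.1, hsupp]
      subst hg
      obtain ⟨c, hc, M, hM, rfl⟩ := hL
      obtain ⟨c', hc', M', hM', hMM⟩ := hL'
      -- If one coefficient were smaller, the rest would contain a positive multiple of `g`.
      have key : ∀ {m m' : List (ι → ℕ)} {a a' : ℚ} {N N' : ι → ℚ}, N ∈ openCone m →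
          N' ∈ openCone m' → ¬ Function.support g ⊆ listSupport m →
          (∀ i, a * g i + N i = a' * g i + N' i) → a' ≤ a := by
        intro m m' a a' N N' hN hN' hgm hNN
        obtain ⟨i, hi, him⟩ := Set.not_subset.1 hgm
        have h1 := hNN i
        rw [eq_zero_of_notMem_listSupport hN him] at h1
        have h2 := openCone_nonneg hN' i
        have h3 : (0 : ℚ) < g i := by exact_mod_cast Nat.pos_of_ne_zero hi
        exact le_of_mul_le_mul_right (by linarith) h3
      have hpt : ∀ i, c * g i + M i = c' * g i + M' i := fun i => congrFun hMM i
      have hcc : c = c' :=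
        le_antisymm (key hM' hM h'.2.2 fun i => (hpt i).symm) (key hM hM' h.2.2 hpt)
      subst hcc
      have hM2 : M = M' := by
        ext i
        simpa using hpt i
      subst hM2
      rw [ih h.1 h'.1 hM hM' ((support_of_mem_openCone hM).symm.trans
        (support_of_mem_openCone hM'))]

theorem openCone_subset {K : Submodule ℚ (ι → ℚ)} {l : List (ι → ℕ)}
    (hl : ∀ g ∈ l, (fun i => (g i : ℚ)) ∈ K) : openCone l ⊆ K := by
  induction l with
  | nil => simp [openCone]
  | cons g l ih =>
    rintro _ ⟨c, -, M, hM, rfl⟩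
    exact K.add_mem (K.smul_mem c (hl g (by simp))) (ih (fun g' hg' => hl g' (by simp [hg'])) hM)

/-- If every nonzero nonnegative vector of `K` contains a generator in its support, then every
nonnegative vector of `K` lies in the open cone of some pulling list. -/
theorem exists_isPulling [Finite ι] {K : Submodule ℚ (ι → ℚ)} {P : (ι → ℕ) → Prop}
    {gen : Set ι → ι → ℕ} (hPK : ∀ g, P g → (fun i => (g i : ℚ)) ∈ K) (hP0 : ∀ g, P g → g ≠ 0)
    (hgen : ∀ L ∈ K, (∀ i, 0 ≤ L i) → L ≠ 0 →
      P (gen (Function.support L)) ∧ Function.support (gen (Function.support L)) ⊆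
        Function.support L)
    (L : ι → ℚ) (hL : L ∈ K) (hL0 : ∀ i, 0 ≤ L i) :
    ∃ l, IsPulling gen l ∧ (∀ g ∈ l, P g) ∧ L ∈ openCone l := by
  induction hn : (Function.support L).ncard using Nat.strong_induction_on generalizing L with
  | _ n ih =>
    by_cases hLz : L = 0
    · exact ⟨[], trivial, by simp, by simp [hLz, openCone]⟩
    obtain ⟨hPg, hsub⟩ := hgen L hL hL0 hLz
    set g := gen (Function.support L) with hg
    have hne : (Function.support g).Nonempty := Function.support_nonempty_iff.2 (hP0 g hPg)
    obtain ⟨f, hf, hmin⟩ := Set.exists_min_image (Function.support g)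
      (fun i => L i / (g i : ℚ)) (Set.toFinite _) hne
    have hpos : ∀ i ∈ Function.support g, (0 : ℚ) < g i := fun i hi => by
      exact_mod_cast Nat.pos_of_ne_zero hi
    set c := L f / (g f : ℚ) with hc
    have hLf : 0 < L f := lt_of_le_of_ne (hL0 f) (Ne.symm (hsub hf))
    have hc0 : 0 < c := div_pos hLf (hpos f hf)
    let M : ι → ℚ := fun i => L i - c * g i
    have hMK : M ∈ K := K.sub_mem hL (K.smul_mem c (hPK g hPg))
    have hM0 : ∀ i, 0 ≤ M i := by
      intro i
      by_cases hi : i ∈ Function.support g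
      · exact sub_nonneg.2 ((le_div_iff₀ (hpos i hi)).1 (hmin i hi))
      · have : g i = 0 := by simpa using hi
        simpa [M, this] using hL0 i
    have hMsub : Function.support M ⊆ Function.support L := by
      intro i hi hLi
      have : g i = 0 := by
        by_contra hgi
        exact hsub hgi hLi
      exact hi (by simp [M, this, hLi])
    have hMf : M f = 0 := by
      have := (hpos f hf).ne'
      simp only [M, hc]
      field_simp
      ring
    have hlt : (Function.support M).ncard < n := by
      rw [← hn]
      exact Set.ncard_lt_ncard ⟨hMsub, fun h => h (hsub hf) hMf⟩ (Set.toFinite _)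
    obtain ⟨l, hl, hlP, hMl⟩ := ih _ hlt M hMK hM0 rfl
    have hLmem : L ∈ openCone (g :: l) := ⟨c, hc0, M, hMl, by ext i; simp [M]⟩
    refine ⟨g :: l, ⟨hl, ?_, ?_⟩, ?_, hLmem⟩
    · rw [← support_of_mem_openCone hLmem]
    · rw [← support_of_mem_openCone hMl]
      exact fun h => h hf hMf
    · simpa using ⟨hPg, hlP⟩

theorem le_of_mem_openCone {l : List (ι → ℕ)} {e f : ι} (hl : ∀ g ∈ l, g f ≤ g e) {L : ι → ℚ}
    (hL : L ∈ openCone l) : L f ≤ L e := by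
  induction l generalizing L with
  | nil => rw [openCone, Set.mem_singleton_iff] at hL; simp [hL]
  | cons g l ih =>
    obtain ⟨c, hc, M, hM, rfl⟩ := hL
    have h1 := ih (fun g' hg' => hl g' (by simp [hg'])) hM
    have h2 : (g f : ℚ) ≤ g e := by exact_mod_cast hl g (by simp)
    have h3 := mul_le_mul_of_nonneg_left h2 hc.le
    simp only
    linarith

/-- `P` singles out nonzero vectors of `K` such that every nonzero nonnegative vector of `K` has
one of them in its support. -/
structure Generates (K : Submodule ℚ (ι → ℚ)) (P : (ι → ℕ) → Prop) : Prop where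
  mem : ∀ g, P g → (fun i => (g i : ℚ)) ∈ K
  ne_zero : ∀ g, P g → g ≠ 0
  exists_support_subset : ∀ L ∈ K, (∀ i, 0 ≤ L i) → L ≠ 0 →
    ∃ g, P g ∧ Function.support g ⊆ Function.support L

theorem Generates.exists_gen {K : Submodule ℚ (ι → ℚ)} {P : (ι → ℕ) → Prop}
    (h : Generates K P) : ∃ gen : Set ι → ι → ℕ, ∀ L ∈ K, (∀ i, 0 ≤ L i) → L ≠ 0 →
      P (gen (Function.support L)) ∧ Function.support (gen (Function.support L)) ⊆
        Function.support L := by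
  have : ∀ S : Set ι, ∃ g : ι → ℕ, (∃ g, P g ∧ Function.support g ⊆ S) →
      P g ∧ Function.support g ⊆ S := by
    intro S
    by_cases hS : ∃ g, P g ∧ Function.support g ⊆ S
    · exact ⟨hS.choose, fun _ => hS.choose_spec⟩
    · exact ⟨0, fun h => absurd h hS⟩
  choose gen hgen using this
  exact ⟨gen, fun L hL hL0 hLz => hgen _ (h.exists_support_subset L hL hL0 hLz)⟩

/-- A coordinate that is maximal in all generators is maximal in all nonnegative vectors. -/
theorem Generates.le_of_forall_le [Finite ι] {K : Submodule ℚ (ι → ℚ)} {P : (ι → ℕ) → Prop}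
    (h : Generates K P) {e f : ι} (hP : ∀ g, P g → g f ≤ g e) {L : ι → ℚ} (hL : L ∈ K)
    (hL0 : ∀ i, 0 ≤ L i) : L f ≤ L e := by
  obtain ⟨gen, hgen⟩ := h.exists_gen
  obtain ⟨l, -, hlP, hl⟩ := exists_isPulling h.mem h.ne_zero hgen L hL hL0
  exact le_of_mem_openCone (fun g hg => hP g (hlP g hg)) hl

/-- If `e` is a maximal coordinate of every generator and all the values `g e` divide `s`, then the
number of lattice points of `K` in the dilated cube `[0, k]^ι` is a quasipolynomial in `k` of
quasiperiod `s`. -/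
theorem Generates.exists_quasipolynomial [Finite ι] {K : Submodule ℚ (ι → ℚ)}
    {P : (ι → ℕ) → Prop} (h : Generates K P) {e : ι} {s : ℕ} (hs : 0 < s)
    (hPe : ∀ g, P g → ∀ f, g f ≤ g e) (hPs : ∀ g, P g → g e ∣ s) :
    ∃ φ : ℕ → ℚ[X], ∀ k : ℕ,
      ({L : ι → ℕ | (fun i => (L i : ℚ)) ∈ K ∧ ∀ f, L f ≤ k}.ncard : ℚ) =
        (φ (k % s)).eval (k : ℚ) := by
  obtain ⟨gen, hgen⟩ := h.exists_gen
  have hfin : {l : List (ι → ℕ) | IsPulling gen l ∧ ∀ g ∈ l, P g}.Finite :=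
    (finite_isPulling gen).subset fun l hl => hl.1
  have hT : ∀ l, l ∈ hfin.toFinset ↔ IsPulling gen l ∧ ∀ g ∈ l, P g := by simp
  have hcount : HasQuasiCount s 0 fun k => ⋃ l ∈ hfin.toFinset, conePoints l e 0 k := by
    refine HasQuasiCount.biUnion _ (fun l k => conePoints l e 0 k) (fun l hl => ?_) ?_
    · obtain ⟨hl1, hl2⟩ := (hT l).1 hl
      refine hasQuasiCount_conePoints hs e l hl1.isTriangular (fun g hg => ⟨fun h0 => ?_,
        hPs g (hl2 g hg)⟩) 0
      refine h.ne_zero g (hl2 g hg) (funext fun f => ?_)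
      have := hPe g (hl2 g hg) f
      simp only [Pi.zero_apply]
      omega
    · rintro l hl l' hl' k L ⟨⟨M, hM, hL⟩, -⟩ ⟨⟨M', hM', hL'⟩, -⟩
      have : M = M' := by
        ext i
        have := (hL i).symm.trans (hL' i)
        simpa using this
      subst this
      exact ((hT l).1 hl).1.unique ((hT l').1 hl').1 hM hM'
  obtain ⟨-, φ, hφ⟩ := hcount
  refine ⟨fun a => φ a, fun k => ?_⟩
  have hk := hφ k (by simp)
  push_cast at hk ⊢
  rw [← hk]
  congr 1
  have hinj : Function.Injective (fun (L : ι → ℕ) i => (L i : ℤ)) := by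
    intro L L' hLL
    ext i
    simpa using congrFun hLL i
  rw [← Set.ncard_image_of_injective _ hinj]
  congr 1
  ext L
  simp only [Set.mem_iUnion, hT]
  constructor
  · rintro ⟨L, ⟨hLK, hLk⟩, rfl⟩
    obtain ⟨l, hl, hlP, hLl⟩ := exists_isPulling h.mem h.ne_zero hgen _ hLK (fun i => by positivity)
    exact ⟨l, ⟨hl, hlP⟩, ⟨_, hLl, fun i => by simp⟩, Int.ofNat_le.2 (hLk e)⟩
  · rintro ⟨l, ⟨hl, hlP⟩, ⟨M, hM, hL⟩, hLk⟩
    have hLM : ∀ i, (L i : ℚ) = M i := fun i => by simpa using hL i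
    have hLnonneg : ∀ i, 0 ≤ L i := fun i => by
      have := openCone_nonneg hM i
      rw [← hLM i] at this
      exact_mod_cast this
    have hcast : ∀ i, ((L i).toNat : ℤ) = L i := fun i => Int.toNat_of_nonneg (hLnonneg i)
    have hcastQ : ∀ i, ((L i).toNat : ℚ) = M i := fun i => by
      rw [← hLM i]
      exact_mod_cast congrArg (Int.cast : ℤ → ℚ) (hcast i)
    refine ⟨fun i => (L i).toNat, ⟨?_, fun f => ?_⟩, funext hcast⟩
    · simp only [hcastQ]
      exact openCone_subset (fun g hg => h.mem g (hlP g hg)) hM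
    · have h1 := le_of_mem_openCone (f := f) (fun g hg => hPe g (hlP g hg) f) hM
      rw [← hLM, ← hLM] at h1
      have h2 : L f ≤ L e := by exact_mod_cast h1
      have := hcast f
      simp only
      omega

/-! ### Magic labelings supported on a given set of edges -/

variable {α β : Type*}

open Classical in
/-- The sum of the labels of the edges containing `v`, for labels in any additive monoid. -/
noncomputable def incSum {R : Type*} [AddCommMonoid R] (G : Graph α β) [Fintype G.edgeSet]
    (L : G.edgeSet → R) (v : α) : R :=
  ∑ e : G.edgeSet, if G.Inc e v then L e else 0

theorem vertexSum_eq_incSum (G : Graph α β) [Fintype G.edgeSet] (L : G.edgeSet → ℕ) (v : α) :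
    vertexSum G L v = incSum G L v := by
  classical
  rw [vertexSum, incSum, finsum_mem_def, finsum_eq_sum_of_fintype]
  refine Finset.sum_congr rfl fun e _ => ?_
  simp [Set.indicator_apply]

theorem incSum_natCast (G : Graph α β) [Fintype G.edgeSet] (L : G.edgeSet → ℕ) (v : α) :
    incSum G (fun e => (L e : ℚ)) v = (incSum G L v : ℕ) := by
  simp [incSum]

theorem le_incSum {R : Type*} [AddCommMonoid R] [PartialOrder R] [IsOrderedAddMonoid R]
    (G : Graph α β) [Fintype G.edgeSet] (L : G.edgeSet → R) (hL : ∀ e, 0 ≤ L e) {v : α}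
    {e : G.edgeSet} (he : G.Inc e v) : L e ≤ incSum G L v := by
  classical
  have h := Finset.single_le_sum (f := fun e : G.edgeSet => if G.Inc e v then L e else 0)
    (fun e _ => by split_ifs <;> simp [hL]) (Finset.mem_univ e)
  simpa [he, incSum] using h

/-- The space of rational labelings with equal vertex sums. -/
def magicSpace (G : Graph α β) [Fintype G.edgeSet] : Submodule ℚ (G.edgeSet → ℚ) where
  carrier := {L | ∀ v ∈ G.vertexSet, ∀ w ∈ G.vertexSet, incSum G L v = incSum G L w}
  zero_mem' := by simp [incSum]
  add_mem' := by
    classical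
    intro L L' h h' v hv w hw
    have key : ∀ v, incSum G (L + L') v = incSum G L v + incSum G L' v := by
      intro v
      rw [incSum, incSum, incSum, ← Finset.sum_add_distrib]
      exact Finset.sum_congr rfl fun e _ => by split_ifs <;> simp
    rw [key, key, h v hv w hw, h' v hv w hw]
  smul_mem' := by
    classical
    intro c L h v hv w hw
    have key : ∀ v, incSum G (c • L) v = c * incSum G L v := by
      intro v
      rw [incSum, incSum, Finset.mul_sum]
      exact Finset.sum_congr rfl fun e _ => by split_ifs <;> simp
    rw [key, key, h v hv w hw]

theorem natCast_mem_magicSpace (G : Graph α β) [Fintype G.edgeSet] (L : G.edgeSet → ℕ) :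
    (fun e => (L e : ℚ)) ∈ magicSpace G ↔ IsMagic G L := by
  change (∀ v ∈ G.vertexSet, ∀ w ∈ G.vertexSet, incSum G (fun e => (L e : ℚ)) v =
    incSum G (fun e => (L e : ℚ)) w) ↔ _
  simp only [IsMagic, incSum_natCast, vertexSum_eq_incSum, Nat.cast_inj]

theorem IsMagicOfIndex.isMagic {G : Graph α β} {L : G.edgeSet → ℕ} {r : ℕ}
    (h : IsMagicOfIndex G L r) : IsMagic G L :=
  fun v hv w hw => (h v hv).trans (h w hw).symm

theorem isLink_inc_iff {G : Graph α β} {e : β} {x y v : α} (h : G.IsLink e x y) :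
    G.Inc e v ↔ v = x ∨ v = y :=
  ⟨fun hv => hv.eq_or_eq_of_isLink h, by rintro (rfl | rfl); exacts [h.inc_left, h.inc_right]⟩

/-- A nonzero nonnegative magic labeling, regarded as a symmetric matrix indexed by the vertices,
is a multiple of a doubly stochastic matrix (a loop contributes one diagonal entry), so by
Birkhoff's theorem a permutation moves the vertices along edges of its support. -/
theorem exists_perm_of_mem_magicSpace (G : Graph α β) [Fintype G.edgeSet] [Fintype G.vertexSet]
    {L : G.edgeSet → ℚ} (hL : L ∈ magicSpace G) (hL0 : ∀ e, 0 ≤ L e) (hLz : L ≠ 0) :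
    ∃ σ : Equiv.Perm G.vertexSet, ∃ ε : G.vertexSet → G.edgeSet,
      ∀ x, G.IsLink (ε x) x (σ x) ∧ L (ε x) ≠ 0 := by
  classical
  obtain ⟨f, hf⟩ := Function.ne_iff.1 hLz
  have hfpos : 0 < L f := lt_of_le_of_ne (hL0 f) (Ne.symm hf)
  obtain ⟨u, u', hu⟩ := Graph.exists_isLink_of_mem_edgeSet f.2
  set r := incSum G L u with hr
  have hrpos : 0 < r := hfpos.trans_le (le_incSum G L hL0 hu.inc_left)
  have hsum : ∀ v : G.vertexSet, incSum G L v = r := fun v => hL v v.2 u hu.left_mem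
  let w : G.vertexSet → G.vertexSet → ℚ := fun x y =>
    ∑ e : G.edgeSet, if G.IsLink e x y then L e else 0
  have hwsymm : ∀ x y, w x y = w y x := fun x y =>
    Finset.sum_congr rfl fun e _ => by simp only [Graph.isLink_comm]
  have hrow : ∀ x, ∑ y, w x y = r := by
    intro x
    rw [← hsum x, Finset.sum_comm, incSum]
    refine Finset.sum_congr rfl fun e _ => ?_
    by_cases he : G.Inc e x
    · obtain ⟨y, hy⟩ := he
      have : ∀ z : G.vertexSet, G.IsLink e x z ↔ (⟨y, hy.right_mem⟩ : G.vertexSet) = z := by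
        intro z
        rw [hy.isLink_iff_eq, Subtype.ext_iff]
        exact eq_comm
      simp [this, hy.inc_left]
    · have : ∀ z : G.vertexSet, ¬ G.IsLink e x z := fun z hz => he hz.inc_left
      simp [this, he]
  have hds : Matrix.of (fun x y => w x y / r) ∈ doublyStochastic ℚ G.vertexSet := by
    rw [mem_doublyStochastic_iff_sum]
    simp only [Matrix.of_apply]
    refine ⟨fun x y => div_nonneg (Finset.sum_nonneg fun e _ => ?_) hrpos.le, fun x => ?_,
      fun y => ?_⟩
    · split_ifs <;> simp [hL0]
    · rw [← Finset.sum_div, hrow, div_self hrpos.ne']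
    · simp only [hwsymm _ y]
      rw [← Finset.sum_div, hrow, div_self hrpos.ne']
  obtain ⟨c, hc0, hc1, hcM⟩ := exists_eq_sum_perm_of_mem_doublyStochastic hds
  obtain ⟨σ, -, hσ⟩ : ∃ σ ∈ Finset.univ, 0 < c σ :=
    Finset.exists_lt_of_sum_lt (f := fun _ => (0 : ℚ)) (by simp [hc1])
  have hε : ∀ x : G.vertexSet, ∃ e : G.edgeSet, G.IsLink e x (σ x) ∧ L e ≠ 0 := by
    intro x
    have hpos : 0 < w x (σ x) / r := by
      have h1 : w x (σ x) / r = ∑ τ : Equiv.Perm G.vertexSet,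
          c τ * (τ.permMatrix ℚ : Matrix _ _ ℚ) x (σ x) := by
        have := congrFun (congrFun hcM x) (σ x)
        rw [Matrix.sum_apply] at this
        exact this.symm
      rw [h1]
      refine hσ.trans_le ?_
      have h2 := Finset.single_le_sum
        (f := fun τ : Equiv.Perm G.vertexSet => c τ * (τ.permMatrix ℚ : Matrix _ _ ℚ) x (σ x))
        (fun τ _ => mul_nonneg (hc0 τ) (by
          rw [Equiv.Perm.permMatrix, PEquiv.toMatrix_apply]; split_ifs <;> simp))
        (Finset.mem_univ σ)
      simpa [Equiv.Perm.permMatrix, PEquiv.toMatrix_apply] using h2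
    by_contra! hno
    have : w x (σ x) = 0 := Finset.sum_eq_zero fun e _ => by
      split_ifs with he
      · exact hno e he
      · rfl
    simp [this] at hpos
  choose ε hε using hε
  exact ⟨σ, ε, hε⟩

open Classical in
/-- The labeling that gives to each edge the total weight of the vertices assigned to it. -/
noncomputable def pushLabel (G : Graph α β) [Fintype G.vertexSet] (ε : G.vertexSet → G.edgeSet)
    (w : G.vertexSet → ℕ) (e : G.edgeSet) : ℕ :=
  ∑ x, if ε x = e then w x else 0

theorem support_pushLabel_subset (G : Graph α β) [Fintype G.edgeSet] [Fintype G.vertexSet]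
    {ε : G.vertexSet → G.edgeSet} {w : G.vertexSet → ℕ} {L : G.edgeSet → ℚ}
    (h : ∀ x, L (ε x) ≠ 0) : Function.support (pushLabel G ε w) ⊆ Function.support L := by
  classical
  intro e he
  obtain ⟨x, -, hx⟩ := Finset.exists_ne_zero_of_sum_ne_zero he
  have : ε x = e := by
    by_contra hne
    simp [hne] at hx
  exact this ▸ h x

theorem vertexSum_pushLabel (G : Graph α β) [Fintype G.edgeSet] [Fintype G.vertexSet]
    (ε : G.vertexSet → G.edgeSet) (w a : G.vertexSet → ℕ) (v : α)
    (h : ∀ x, (G.Inc (ε x) v → w x = a x) ∧ (¬ G.Inc (ε x) v → a x = 0)) :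
    vertexSum G (pushLabel G ε w) v = ∑ x, a x := by
  classical
  have h1 : ∀ e : G.edgeSet, (if G.Inc e v then pushLabel G ε w e else 0) =
      ∑ x, if ε x = e then (if G.Inc e v then w x else 0) else 0 := by
    intro e
    split_ifs <;> simp [pushLabel]
  rw [vertexSum_eq_incSum, incSum]
  simp only [h1]
  rw [Finset.sum_comm]
  refine Finset.sum_congr rfl fun x _ => ?_
  rw [Finset.sum_ite_eq]
  simp only [Finset.mem_univ, if_true]
  split_ifs with hx
  exacts [(h x).1 hx, ((h x).2 hx).symm]

/-- The support of a nonzero nonnegative magic labeling contains that of one of index `2`. -/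
theorem exists_index_two (G : Graph α β) [Fintype G.edgeSet] [Fintype G.vertexSet]
    {L : G.edgeSet → ℚ} (hL : L ∈ magicSpace G) (hL0 : ∀ e, 0 ≤ L e) (hLz : L ≠ 0) :
    ∃ g, IsMagicOfIndex G g 2 ∧ Function.support g ⊆ Function.support L := by
  classical
  obtain ⟨σ, ε, hε⟩ := exists_perm_of_mem_magicSpace G hL hL0 hLz
  -- A loop arising from a fixed point of `σ` is counted twice.
  refine ⟨pushLabel G ε fun x => if σ x = x then 2 else 1, fun v hv => ?_,
    support_pushLabel_subset G fun x => (hε x).2⟩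
  lift v to G.vertexSet using hv
  rw [vertexSum_pushLabel G ε _
    (fun x => (if x = v then 1 else 0) + if x = σ.symm v then 1 else 0)]
  · simp [Finset.sum_add_distrib]
  · intro x
    rw [isLink_inc_iff (hε x).1]
    simp only [← Subtype.ext_iff, Equiv.eq_symm_apply]
    rcases eq_or_ne x v with rfl | h1
    · by_cases h2 : σ x = x <;> simp [h2]
    · rcases eq_or_ne (σ x) v with rfl | h2
      · simp [h1, h1.symm]
      · simp [h1, h2, h1.symm, h2.symm]

/-- In a bipartite graph, the support of a nonzero nonnegative magic labeling contains that of one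
of index `1`: use only the permuted vertices of one side. -/
theorem exists_index_one (G : Graph α β) [Fintype G.edgeSet] [Fintype G.vertexSet]
    (hG : IsBipartite G) {L : G.edgeSet → ℚ} (hL : L ∈ magicSpace G) (hL0 : ∀ e, 0 ≤ L e)
    (hLz : L ≠ 0) :
    ∃ g, IsMagicOfIndex G g 1 ∧ Function.support g ⊆ Function.support L := by
  classical
  obtain ⟨A, hA⟩ := hG
  obtain ⟨σ, ε, hε⟩ := exists_perm_of_mem_magicSpace G hL hL0 hLz
  refine ⟨pushLabel G ε fun x => if (x : α) ∈ A then 1 else 0, fun v hv => ?_,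
    support_pushLabel_subset G fun x => (hε x).2⟩
  lift v to G.vertexSet using hv
  rw [vertexSum_pushLabel G ε _
    (fun x => if x = (if (v : α) ∈ A then v else σ.symm v) then 1 else 0)]
  · simp
  · intro x
    rw [isLink_inc_iff (hε x).1]
    have hx := hA _ _ _ (hε x).1
    by_cases hv : (v : α) ∈ A
    · simp only [hv, if_true, ← Subtype.ext_iff]
      constructor
      · rintro (rfl | rfl)
        · simp [hv]
        · have hxA : (x : α) ∉ A := fun h => hx.1 h hv
          have : x ≠ σ x := fun h => hxA (by rw [h]; exact hv)
          simp [hxA, this]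
      · intro h
        have : x ≠ v := fun h' => h (Or.inl h'.symm)
        simp [this]
    · simp only [hv, if_false, ← Subtype.ext_iff, Equiv.eq_symm_apply]
      constructor
      · rintro (rfl | rfl)
        · have : σ v ≠ v := fun h => hv (hx.2 (by rw [h]; exact hv))
          simp [hv, this]
        · simp [hx.2 hv]
      · intro h
        have : σ x ≠ v := fun h' => h (Or.inr h'.symm)
        simp [this]

/-! ### Perfect matchings and magic labelings -/

open Classical in
/-- Twice the indicator function of a perfect matching is magic of index `2`. -/
theorem IsPerfectMatching.isMagicOfIndex_two {G : Graph α β} [Fintype G.edgeSet] {M : Set β}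
    (hM : IsPerfectMatching G M) :
    IsMagicOfIndex G (fun e => if (e : β) ∈ M then 2 else 0) 2 := by
  intro v hv
  obtain ⟨e₀, ⟨h₀, hi₀⟩, huniq⟩ := hM.2.2 v hv
  rw [vertexSum_eq_incSum, incSum]
  rw [Finset.sum_eq_single (⟨e₀, hM.1 h₀⟩ : G.edgeSet)]
  · simp [h₀, hi₀]
  · intro e _ hne
    split_ifs with h1 h2
    · exact absurd (Subtype.ext (huniq e ⟨h2, h1⟩)) hne
    · rfl
    · rfl
  · simp

theorem isPerfectMatching_support {G : Graph α β} [Fintype G.edgeSet] (hG : IsBipartite G)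
    {g : G.edgeSet → ℕ} (hg : IsMagicOfIndex G g 1) :
    IsPerfectMatching G (Subtype.val '' Function.support g) := by
  classical
  refine ⟨by rintro _ ⟨e, -, rfl⟩; exact e.2, ?_, fun v hv => ?_⟩
  · obtain ⟨A, hA⟩ := hG
    intro e _ x hx
    have := hA e x x hx
    tauto
  · have h := hg v hv
    rw [vertexSum_eq_incSum, incSum] at h
    obtain ⟨e, -, he⟩ := Finset.exists_ne_zero_of_sum_ne_zero (h.trans_ne one_ne_zero)
    have hinc : G.Inc e v := by
      by_contra hni
      simp [hni] at he
    rw [← Finset.add_sum_erase _ _ (Finset.mem_univ e)] at h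
    have hrest := Finset.sum_eq_zero_iff.1 (by omega : ∑ e' ∈ Finset.univ.erase e,
      (if G.Inc (e' : β) v then g e' else 0) = 0)
    rw [if_pos hinc] at he
    refine ⟨e, ⟨⟨e, he, rfl⟩, hinc⟩, ?_⟩
    rintro _ ⟨⟨e', he', rfl⟩, hinc'⟩
    by_contra hee
    have := hrest e' (Finset.mem_erase.2 ⟨fun h => hee (congrArg Subtype.val h),
      Finset.mem_univ _⟩)
    rw [if_pos hinc'] at this
    exact he' this

theorem isPerfectMatching_deleteEdges_iff {G : Graph α β} {S M : Set β} :
    IsPerfectMatching (G.deleteEdges S) M ↔ IsPerfectMatching G M ∧ Disjoint M S := by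
  constructor
  · rintro ⟨h1, h2, h3⟩
    have h1' : M ⊆ G.edgeSet \ S := by simpa using h1
    have hd : ∀ e ∈ M, e ∉ S := fun e he => (h1' he).2
    refine ⟨⟨fun e he => (h1' he).1, fun e he x hx => h2 e he x ?_, fun v hv => ?_⟩,
      Set.disjoint_left.2 hd⟩
    · exact Graph.deleteEdges_isLoopAt.2 ⟨hx, hd e he⟩
    · obtain ⟨e, ⟨he, hi⟩, hu⟩ := h3 v hv
      exact ⟨e, ⟨he, (Graph.deleteEdges_inc.1 hi).1⟩,
        fun e' he' => hu e' ⟨he'.1, Graph.deleteEdges_inc.2 ⟨he'.2, hd e' he'.1⟩⟩⟩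
  · rintro ⟨⟨h1, h2, h3⟩, hd⟩
    have hd : ∀ e ∈ M, e ∉ S := fun e he => Set.disjoint_left.1 hd he
    refine ⟨?_, fun e he x hx => h2 e he x (Graph.deleteEdges_isLoopAt.1 hx).1, fun v hv => ?_⟩
    · have : M ⊆ G.edgeSet \ S := fun e he => ⟨h1 he, hd e he⟩
      simpa using this
    · obtain ⟨e, ⟨he, hi⟩, hu⟩ := h3 v hv
      exact ⟨e, ⟨he, Graph.deleteEdges_inc.2 ⟨hi, hd e he⟩⟩,
        fun e' he' => hu e' ⟨he'.1, (Graph.deleteEdges_inc.1 he'.2).1⟩⟩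

theorem IsMagicOfIndex.ne_zero {G : Graph α β} [Fintype G.edgeSet] {g : G.edgeSet → ℕ} {r : ℕ}
    (hg : IsMagicOfIndex G g r) (hr : r ≠ 0) {v : α} (hv : v ∈ G.vertexSet) : g ≠ 0 := by
  rintro rfl
  have := hg v hv
  rw [vertexSum_eq_incSum] at this
  simp [incSum] at this
  exact hr this.symm

theorem IsMagicOfIndex.le {G : Graph α β} [Fintype G.edgeSet] {g : G.edgeSet → ℕ} {r : ℕ}
    (hg : IsMagicOfIndex G g r) (e : G.edgeSet) : g e ≤ r := by
  obtain ⟨x, y, hxy⟩ := Graph.exists_isLink_of_mem_edgeSet e.2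
  rw [← hg x hxy.left_mem, vertexSum_eq_incSum]
  exact le_incSum G g (fun _ => Nat.zero_le _) hxy.inc_left

theorem generates_index_two (G : Graph α β) [Fintype G.edgeSet] [Fintype G.vertexSet]
    (hE : G.edgeSet.Nonempty) : Generates (magicSpace G) fun g => IsMagicOfIndex G g 2 := by
  obtain ⟨e, he⟩ := hE
  obtain ⟨x, y, hxy⟩ := Graph.exists_isLink_of_mem_edgeSet he
  exact ⟨fun g hg => (natCast_mem_magicSpace G g).2 hg.isMagic,
    fun g hg => hg.ne_zero two_ne_zero hxy.left_mem, fun L => exists_index_two G⟩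

theorem generates_index_one (G : Graph α β) [Fintype G.edgeSet] [Fintype G.vertexSet]
    (hG : IsBipartite G) (hE : G.edgeSet.Nonempty) :
    Generates (magicSpace G) fun g => IsMagicOfIndex G g 1 := by
  obtain ⟨e, he⟩ := hE
  obtain ⟨x, y, hxy⟩ := Graph.exists_isLink_of_mem_edgeSet he
  exact ⟨fun g hg => (natCast_mem_magicSpace G g).2 hg.isMagic,
    fun g hg => hg.ne_zero one_ne_zero hxy.left_mem, fun L => exists_index_one G hG⟩

/-! ### Magic counts and matching preclusion -/

theorem hasQuasiperiod_magicCount (G : Graph α β) [Fintype G.edgeSet]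
    {P : (G.edgeSet → ℕ) → Prop} (h : Generates (magicSpace G) P) {e : G.edgeSet} {s : ℕ}
    (hs : 0 < s) (hPe : ∀ g, P g → ∀ f, g f ≤ g e) (hPs : ∀ g, P g → g e ∣ s) :
    HasQuasiperiod (fun k => (magicCount G k : ℂ)) s := by
  obtain ⟨φ, hφ⟩ := h.exists_quasipolynomial hs hPe hPs
  refine ⟨hs, fun a => (φ a).map (algebraMap ℚ ℂ), fun k => ?_⟩
  have h1 := congrArg (algebraMap ℚ ℂ) (hφ k)
  simp only [natCast_mem_magicSpace] at h1
  rw [← Polynomial.eval_map_apply, map_natCast, map_natCast] at h1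
  exact h1

theorem isPolynomial_of_hasQuasiperiod_one {F : ℕ → ℂ} (h : HasQuasiperiod F 1) :
    IsPolynomial F := by
  obtain ⟨-, φ, hφ⟩ := h
  exact ⟨φ 0, fun t => by rw [hφ t, Nat.mod_one]⟩

theorem HasCommonMaxEdge.hasQuasiperiod_two {G : Graph α β} [Fintype G.edgeSet]
    [Fintype G.vertexSet] (h : HasCommonMaxEdge G) :
    HasQuasiperiod (fun k => (magicCount G k : ℂ)) 2 := by
  obtain ⟨e, he⟩ := h
  have hgen := generates_index_two G ⟨e, e.2⟩
  refine hasQuasiperiod_magicCount G hgen two_pos he fun g hg => ?_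
  have h2 := hg.le e
  have h0 : g e ≠ 0 := fun h0 =>
    hgen.ne_zero g hg (funext fun f => Nat.le_zero.1 (h0 ▸ he g hg f))
  interval_cases hge : g e <;> simp_all

theorem HasCommonMaxEdge.isPolynomial {G : Graph α β} [Fintype G.edgeSet] [Fintype G.vertexSet]
    (h : HasCommonMaxEdge G) (hG : IsBipartite G) :
    IsPolynomial (fun k => (magicCount G k : ℂ)) := by
  obtain ⟨e, he⟩ := h
  have hgen := generates_index_one G hG ⟨e, e.2⟩
  have hmax : ∀ g, IsMagicOfIndex G g 1 → ∀ f, g f ≤ g e := by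
    intro g hg f
    exact_mod_cast (generates_index_two G ⟨e, e.2⟩).le_of_forall_le (fun g' hg' => he g' hg' f)
      ((natCast_mem_magicSpace G g).2 hg.isMagic) (fun i => by positivity)
  refine isPolynomial_of_hasQuasiperiod_one
    (hasQuasiperiod_magicCount G hgen one_pos hmax fun g hg => ?_)
  have h0 : g e ≠ 0 := fun h0 =>
    hgen.ne_zero g hg (funext fun f => Nat.le_zero.1 (h0 ▸ hmax g hg f))
  have h1 := hg.le e
  rw [show g e = 1 by omega]

theorem exists_edge_mem_isPerfectMatching {G : Graph α β} (h : matchingPreclusion G ≤ 1)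
    (hE : G.edgeSet.Nonempty) :
    ∃ e ∈ G.edgeSet, ∀ M, IsPerfectMatching G M → e ∈ M := by
  obtain ⟨S, ⟨hSE, hS⟩, hcard⟩ : ∃ S ∈ {S : Set β | S ⊆ G.edgeSet ∧
      ¬ ∃ M, IsPerfectMatching (G.deleteEdges S) M}, S.encard ≤ 1 := by
    by_contra hno
    have : (2 : ℕ∞) ≤ matchingPreclusion G := le_iInf₂ fun S hS => by
      have := Order.add_one_le_of_lt (not_le.1 fun hle => hno ⟨S, hS, hle⟩)
      rwa [one_add_one_eq_two] at this
    exact absurd (this.trans h) (by norm_num)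
  obtain ⟨e, he, hSe⟩ : ∃ e ∈ G.edgeSet, S ⊆ {e} := by
    rcases Set.encard_le_one_iff_eq.1 hcard with rfl | ⟨e, rfl⟩
    · obtain ⟨e, he⟩ := hE
      exact ⟨e, he, Set.empty_subset _⟩
    · exact ⟨e, hSE rfl, subset_rfl⟩
  refine ⟨e, he, fun M hM => ?_⟩
  by_contra heM
  refine hS ⟨M, isPerfectMatching_deleteEdges_iff.2 ⟨hM, Set.disjoint_right.2 fun f hf => ?_⟩⟩
  rw [hSe hf]
  exact heM

theorem hasCommonMaxEdge_of_matchingPreclusion_le_one {G : Graph α β} [Fintype G.edgeSet]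
    [Fintype G.vertexSet] (hG : IsBipartite G) (hE : G.edgeSet.Nonempty)
    (h : matchingPreclusion G ≤ 1) : HasCommonMaxEdge G := by
  obtain ⟨e, he, hM⟩ := exists_edge_mem_isPerfectMatching h hE
  refine ⟨⟨e, he⟩, fun L hL f => ?_⟩
  have hle : ∀ g, IsMagicOfIndex G g 1 → g f ≤ g ⟨e, he⟩ := by
    intro g hg
    obtain ⟨e', he', hee⟩ := hM _ (isPerfectMatching_support hG hg)
    have : e' = ⟨e, he⟩ := Subtype.ext hee
    subst this
    have h1 := hg.le f
    have h2 : g ⟨e, he⟩ ≠ 0 := he'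
    omega
  exact_mod_cast (generates_index_one G hG hE).le_of_forall_le hle
    ((natCast_mem_magicSpace G L).2 hL.isMagic) (fun i => by positivity)

theorem HasCommonMaxEdge.matchingPreclusion_le_one {G : Graph α β} [Fintype G.edgeSet]
    (h : HasCommonMaxEdge G) : matchingPreclusion G ≤ 1 := by
  classical
  obtain ⟨e, he⟩ := h
  refine (iInf₂_le ({(e : β)} : Set β) ⟨by simp, ?_⟩).trans (Set.encard_singleton _).le
  rintro ⟨M, hM⟩
  obtain ⟨hM, hd⟩ := isPerfectMatching_deleteEdges_iff.1 hM
  have heM : (e : β) ∉ M := fun h => Set.disjoint_left.1 hd h rfl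
  obtain ⟨x, y, hxy⟩ := Graph.exists_isLink_of_mem_edgeSet e.2
  obtain ⟨f, ⟨hf, -⟩, -⟩ := hM.2.2 x hxy.left_mem
  have := he _ hM.isMagicOfIndex_two ⟨f, hM.1 hf⟩
  simp [heM, hf] at this

theorem isPolynomial_magicCount_of_edgeSet_not_nonempty {G : Graph α β} (h : ¬ G.edgeSet.Nonempty) :
    IsPolynomial (fun k => (magicCount G k : ℂ)) := by
  have : IsEmpty G.edgeSet := Set.isEmpty_coe_sort.2 (Set.not_nonempty_iff_eq_empty.1 h)
  refine ⟨C (magicCount G 0 : ℂ), fun t => ?_⟩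
  simp [magicCount]

end MagicGraph

theorem mainTheorem2 {α β : Type*} (G : Graph α β)
    (hV : G.vertexSet.Finite) (hE : G.edgeSet.Finite) :
    (MagicGraph.HasCommonMaxEdge G →
      (∃ s ≤ 2, MagicGraph.HasQuasiperiod (fun k => (MagicGraph.magicCount G k : ℂ)) s) ∧
      (MagicGraph.IsBipartite G →
        MagicGraph.IsPolynomial (fun k => (MagicGraph.magicCount G k : ℂ)))) ∧
    (MagicGraph.IsBipartite G → Even G.vertexSet.ncard →
      (MagicGraph.matchingPreclusion G ≤ 1 →
        MagicGraph.IsPolynomial (fun k => (MagicGraph.magicCount G k : ℂ))) ∧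
      (G.edgeSet.Nonempty →
        (MagicGraph.HasCommonMaxEdge G ↔ MagicGraph.matchingPreclusion G ≤ 1))) := by
  have := hV.fintype
  have := hE.fintype
  refine ⟨fun h => ⟨⟨2, le_rfl, h.hasQuasiperiod_two⟩, h.isPolynomial⟩, fun hG _ => ⟨fun h => ?_,
    fun hne => ⟨fun h => h.matchingPreclusion_le_one,
      MagicGraph.hasCommonMaxEdge_of_matchingPreclusion_le_one hG hne⟩⟩⟩
  by_cases hne : G.edgeSet.Nonempty
  · exact (MagicGraph.hasCommonMaxEdge_of_matchingPreclusion_le_one hG hne h).isPolynomial hG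
  · exact MagicGraph.isPolynomial_magicCount_of_edgeSet_not_nonempty hne
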